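/- A \emph{preposet} is a set $P$ with a reflexive relation $\preceq$ whose transitive closure $\preceq\!\preceq$ is a partial order; a \emph{chain} is a subset of $P$ any two elements of which are related by $\preceq$ in one of the two directions. The \emph{geometric realization} $|P|$ is the subspace of $[0,1]^P$, with the metric $d(f,g)=\sup_{s\in P}|f(s)-g(s)|$, that is the union over all nonempty finite chains $C$ of the convex hulls of the sets $\{\chi_p\mid p\in C\}$, where $\chi_p\colon P\to\{0,1\}$ is the characteristic function of $\{s\in P\mid s\preceq\!\preceq p\}$. A \emph{uniform homotopy} between maps $X\to Y$ of uniform spaces is a homotopy $X\times[0,1]\to Y$ that is uniformly continuous. Uniform spaces $X$ and $Y$ are \emph{uniformly homotopy equivalent} if there are uniformly continuous maps $f\colon X\to Y$ and $g\colon Y\to X$ such that $gf$ and $fg$ are uniformly homotopic to the identity maps. A \emph{uniform ANR} is a metrizable uniform space $X$ such that, whenever $X$ is uniformly embedded as a closed subset of a metrizable uniform space $Y$, there is a uniformly continuous retraction onto $X$ of some uniform neighborhood of $X$ in $Y$. A metrizable uniform space $X$ is \emph{uniformly locally contractible} if for every entourage $U$ of $X$ there is an entourage $V$ of $X$ such that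 for every metrizable uniform space $Z$ and all uniformly continuous maps $f,g\colon Z\to X$ with $(f(z),g(z))\in V$ for all $z\in Z$, there is a uniform homotopy $H$ from $f$ to $g$ with $(H(z,s),H(z,t))\in U$ for all $z\in Z$ and $s,t\in[0,1]$. \textbf{Theorem.} There exists a countable preposet $P$ such that (1) $|P|$ is not uniformly homotopy equivalent to any uniform ANR; (2) $|P|$ is not uniformly homotopy equivalent to any uniformly locally contractible metrizable uniform space; (3) for every $\varepsilon>0$ there exists a continuous map $S^1\to|P|$ that is not null-homotopic and whose image has diameter less than $\varepsilon$. -/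

import Mathlib

open Set Filter Topology Uniformity

universe u

/-- A preposet: a reflexive relation on the set `P` whose transitive closure is a partial order
(equivalently, an acyclic digraph together with its diagonal). -/
structure Preposet (P : Type u) where
  rel : P → P → Prop
  rel_refl : ∀ p, rel p p
  closure_antisymm : ∀ p q,
    Relation.ReflTransGen rel p q → Relation.ReflTransGen rel q p → p = q

namespace Preposet

variable {P : Type u}

/-- The cone of `p` in the transitive closure. -/
def cone (R : Preposet P) (p : P) : Set P :=
  {s | Relation.ReflTransGen R.rel s p}

/-- The vertex of the cube `[0,1]^P` corresponding to `p`: the characteristic function of the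
cone of `p`. -/
noncomputable def vertex (R : Preposet P) (p : P) : P → ℝ :=
  (R.cone p).indicator 1

/-- The geometric realization as a subset of `[0,1]^P` with the sup metric: the union of the convex
hulls of all nonempty finite chains (sets of elements that are pairwise related by `rel` itself,
not only by its transitive closure). The type `P →ᵤ unitInterval` of all functions `P → [0,1]`
carries Mathlib's sup metric `dist f g = ⨆ s, |f s - g s|`. -/
def realization (R : Preposet P) : Set (UniformFun P unitInterval) :=
  {f | ∃ C : Set P, C.Finite ∧ C.Nonempty ∧ IsChain R.rel C ∧
    (fun s => ((UniformFun.toFun f s : unitInterval) : ℝ)) ∈ convexHull ℝ (R.vertex '' C)}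

end Preposet

/-- Two maps are uniformly homotopic: they are joined by a uniformly continuous homotopy
`X × [0,1] → Y`. -/
def UniformlyHomotopic {X Y : Type*} [UniformSpace X] [UniformSpace Y] (f g : X → Y) : Prop :=
  ∃ H : X × unitInterval → Y, UniformContinuous H ∧ (∀ x, H (x, 0) = f x) ∧ ∀ x, H (x, 1) = g x

/-- Uniform homotopy equivalence of uniform spaces. -/
def UniformlyHomotopyEquivalent (X Y : Type*) [UniformSpace X] [UniformSpace Y] : Prop :=
  ∃ (f : X → Y) (g : Y → X), UniformContinuous f ∧ UniformContinuous g ∧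
    UniformlyHomotopic (g ∘ f) id ∧ UniformlyHomotopic (f ∘ g) id

/-- A uniform space is metrizable: Hausdorff with a countable base of entourages. -/
def IsUniformlyMetrizable (X : Type*) [UniformSpace X] : Prop :=
  T0Space X ∧ (𝓤 X).IsCountablyGenerated

/-- Uniform local contractibility: for each `U` there is a `V` such that any two `V`-close uniformly
continuous maps from a metrizable uniform space to `X` are joined by a uniformly continuous
homotopy all of whose tracks are `U`-small. -/
def UniformlyLocallyContractible (X : Type u) [UniformSpace X] : Prop :=
  ∀ U ∈ 𝓤 X, ∃ V ∈ 𝓤 X, ∀ (Z : Type u) [UniformSpace Z], IsUniformlyMetrizable Z →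
    ∀ f g : Z → X, UniformContinuous f → UniformContinuous g → (∀ z, (f z, g z) ∈ V) →
      ∃ H : Z × unitInterval → X, UniformContinuous H ∧ (∀ z, H (z, 0) = f z) ∧
        (∀ z, H (z, 1) = g z) ∧ ∀ z s t, (H (z, s), H (z, t)) ∈ U

/-- A uniform ANR: a metrizable uniform space `X` such that, whenever it is uniformly embedded onto
a closed subset of a metrizable uniform space `Y`, it is a uniform retract of some uniform
neighborhood `N` of it in `Y`. -/
def IsUniformANR (X : Type u) [UniformSpace X] : Prop :=
  IsUniformlyMetrizable X ∧
    ∀ (Y : Type u) [UniformSpace Y], IsUniformlyMetrizable Y →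
      ∀ i : X → Y, IsUniformEmbedding i → IsClosed (range i) →
        ∃ N : Set Y, (∃ V ∈ 𝓤 Y, ∀ x y, (i x, y) ∈ V → y ∈ N) ∧
          ∃ r : N → X, UniformContinuous r ∧ ∀ (x : X) (hx : i x ∈ N), r ⟨i x, hx⟩ = x

/-! Both classes of target spaces have a scale below which every loop is nullhomotopic
(`SmallLoopsNullhomotopic`), and a uniform homotopy equivalence would transfer such a scale to
`|P|`. So it suffices to find arbitrarily small essential loops in `|P|`. For `natModFour`, points
of `|P|` are tail functions of finitely supported probability measures on `ℕ` whose support avoids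
opposite residues mod 4. Weighting the mass at `s` by `I ^ s` therefore gives a continuous
nonvanishing `charge`, which detects winding. The sup metric sees only tails: if the mass is spread
evenly over `n` blocks of four consecutive numbers, moving it around inside the blocks changes each
tail by at most `1/n`. This yields loops of diameter at most `1/n` whose charge winds once around
`0`. -/

/-! ### Detecting essential loops. -/

/-- The identity of the circle is not nullhomotopic. -/
theorem Circle.not_nullhomotopic_id : ¬ (ContinuousMap.id Circle).Nullhomotopic := by
  rintro ⟨y, ⟨H⟩⟩
  obtain ⟨e, rfl⟩ : ∃ e, Circle.exp e = y := ⟨_, Circle.exp_arg y⟩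
  have cov := Circle.isCoveringMap_exp
  have h0 : ∀ a, H.symm.toContinuousMap (0, a) = Circle.exp (ContinuousMap.const Circle e a) :=
    fun a => H.symm.apply_zero a
  let L := cov.liftHomotopy H.symm.toContinuousMap (ContinuousMap.const Circle e) h0
  have hL : ∀ z, Circle.exp (L (1, z)) = z := fun z =>
    (congrFun (cov.liftHomotopy_lifts _ _ h0) (1, z)).trans (H.symm.apply_one z)
  -- Both sides lift `Circle.exp` and agree at `0`, but only the left one is `2π`-periodic.
  have key : (fun t : ℝ => L (1, Circle.exp t)) = fun t => t + L (1, 1) := by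
    refine cov.eq_of_comp_eq (by fun_prop) (by fun_prop) ?_ 0 (by simp)
    funext t
    simp [hL, Circle.exp_add]
  have := congrFun key (2 * Real.pi)
  simp only [Circle.exp_two_pi] at this
  linarith [Real.pi_pos]

/-- A loop whose radial projection is the identity of the circle is not nullhomotopic, for any
continuous nonvanishing complex function on the target. -/
theorem not_nullhomotopic_of_comp_eq_smul {Y : Type*} [TopologicalSpace Y] (γ : C(Circle, Y))
    {ρ : Y → ℂ} (hρ : Continuous ρ) (hρ0 : ∀ y, ρ y ≠ 0)
    (h : ∀ z, ∃ r : ℝ, 0 < r ∧ ρ (γ z) = r * z) : ¬ γ.Nullhomotopic := by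
  intro hγ
  let π : C(Y, Circle) :=
    { toFun := fun y => ⟨ρ y / ‖ρ y‖, by
        have := hρ0 y
        simp [Submonoid.unitSphere, this]⟩
      continuous_toFun := by
        refine Continuous.subtype_mk (hρ.div (by fun_prop) fun y => ?_) _
        simpa using hρ0 y }
  have : π.comp γ = ContinuousMap.id Circle := by
    ext z
    obtain ⟨r, hr, hz⟩ := h z
    change ρ (γ z) / ‖ρ (γ z)‖ = z
    have : (r : ℂ) ≠ 0 := by exact_mod_cast hr.ne'
    rw [hz, norm_mul, Circle.norm_coe, Complex.norm_real, Real.norm_of_nonneg hr.le]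
    field_simp
  exact Circle.not_nullhomotopic_id (this ▸ hγ.comp_right π)

/-! ### Small loops in uniform ANRs and uniformly locally contractible spaces. -/

/-- Every loop which is uniformly close enough to a point is nullhomotopic. -/
def SmallLoopsNullhomotopic (X : Type*) [UniformSpace X] : Prop :=
  ∃ V ∈ 𝓤 X, ∀ (γ : C(Circle, X)) (c : X), (∀ z, (γ z, c) ∈ V) → γ.Nullhomotopic

theorem UniformlyLocallyContractible.smallLoopsNullhomotopic {X : Type u} [UniformSpace X]
    (h : UniformlyLocallyContractible X) : SmallLoopsNullhomotopic X := by
  obtain ⟨V, hV, hVX⟩ := h univ univ_mem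
  refine ⟨V, hV, fun γ c hγ => ?_⟩
  have hγu : UniformContinuous γ := CompactSpace.uniformContinuous_of_continuous γ.continuous
  have : (𝓤 Circle).IsCountablyGenerated :=
    inferInstanceAs (𝓤 (Submonoid.unitSphere ℂ)).IsCountablyGenerated
  obtain ⟨H, hH, hH0, hH1, -⟩ := hVX (ULift.{u} Circle)
    ⟨inferInstance, Filter.comap.isCountablyGenerated (𝓤 Circle) _⟩ (fun z => γ z.down) (fun _ => c)
    (hγu.comp uniformContinuous_comap) uniformContinuous_const (fun z => hγ z.down)
  have hd : Continuous (ULift.up : Circle → ULift.{u} Circle) := continuous_uliftUp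
  exact ⟨c, ⟨{
    toFun := fun p => H (ULift.up p.2, p.1)
    continuous_toFun := hH.continuous.comp (by fun_prop)
    map_zero_left := fun z => hH0 _
    map_one_left := fun z => hH1 _ }⟩⟩

section Kuratowski

variable {X : Type u} [MetricSpace X]

/-- The Kuratowski embedding based at `x₀` into the bounded continuous functions. -/
noncomputable def kuratowskiMap (x₀ x : X) : BoundedContinuousFunction X ℝ :=
  BoundedContinuousFunction.ofNormedAddCommGroup (fun y => dist x y - dist x₀ y) (by fun_prop)
    (dist x x₀) fun y => abs_dist_sub_le x x₀ y

theorem kuratowskiMap_apply (x₀ x y : X) : kuratowskiMap x₀ x y = dist x y - dist x₀ y := rfl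

theorem isometry_kuratowskiMap (x₀ : X) : Isometry (kuratowskiMap x₀) := by
  refine Isometry.of_dist_eq fun x x' => le_antisymm ?_ ?_
  · refine (BoundedContinuousFunction.dist_le dist_nonneg).2 fun y => ?_
    simpa [Real.dist_eq, kuratowskiMap_apply] using abs_dist_sub_le x x' y
  · simpa [Real.dist_eq, kuratowskiMap_apply] using
      BoundedContinuousFunction.dist_coe_le_dist (f := kuratowskiMap x₀ x)
        (g := kuratowskiMap x₀ x') x'

/-- A metric space is closed in the convex hull of its Kuratowski image. -/
theorem mem_range_kuratowskiMap_of_mem_closure (x₀ : X) {F : BoundedContinuousFunction X ℝ}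
    (hF : F ∈ convexHull ℝ (range (kuratowskiMap x₀)))
    (hF' : F ∈ closure (range (kuratowskiMap x₀))) : F ∈ range (kuratowskiMap x₀) := by
  rw [mem_convexHull_iff_exists_fintype] at hF
  obtain ⟨ι, _, w, z, hw0, hw1, hz, rfl⟩ := hF
  choose y hy using hz
  obtain ⟨j, hj⟩ : ∃ j, 0 < w j := by
    by_contra! hcon
    have := Finset.sum_nonpos fun i (_ : i ∈ Finset.univ) => hcon i
    linarith
  refine ⟨y j, ?_⟩
  -- If `x` has image near the combination, evaluating at `x` bounds the average of the `dist (y i)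
  -- x`, hence `dist (y j) x`. As `j` does not depend on `ε`, the combination is the image of `y j`.
  have key : ∀ ε > 0, dist (kuratowskiMap x₀ (y j)) (∑ i, w i • z i) ≤ ε / w j + ε := by
    intro ε hε
    obtain ⟨_, ⟨x, rfl⟩, hx⟩ := Metric.mem_closure_iff.1 hF' ε hε
    have h1 := (BoundedContinuousFunction.dist_coe_le_dist (f := ∑ i, w i • z i)
      (g := kuratowskiMap x₀ x) x).trans hx.le
    have h2 : (∑ i, w i • z i) x - kuratowskiMap x₀ x x = ∑ i, w i * dist (y i) x := by
      have : (∑ i, w i • z i) x = ∑ i, w i * (dist (y i) x - dist x₀ x) := by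
        simp [← hy, kuratowskiMap_apply]
      rw [this, kuratowskiMap_apply]
      simp only [mul_sub, Finset.sum_sub_distrib, ← Finset.sum_mul, hw1, dist_self]
      ring
    rw [Real.dist_eq, h2] at h1
    have h3 : w j * dist (y j) x ≤ ε :=
      ((Finset.single_le_sum (f := fun i => w i * dist (y i) x)
        (fun i _ => mul_nonneg (hw0 i) dist_nonneg) (Finset.mem_univ j)).trans
          (le_abs_self _)).trans h1
    have h4 : dist (y j) x ≤ ε / w j := by
      rw [le_div_iff₀ hj]; linarith
    calc _ ≤ dist (kuratowskiMap x₀ (y j)) (kuratowskiMap x₀ x) +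
          dist (kuratowskiMap x₀ x) (∑ i, w i • z i) := dist_triangle _ _ _
      _ ≤ _ := by
        rw [(isometry_kuratowskiMap x₀).dist_eq, dist_comm (kuratowskiMap x₀ x)]
        exact add_le_add h4 hx.le
  refine dist_le_zero.1 (le_of_forall_pos_le_add fun δ hδ => ?_)
  have hw : 0 < 1 / w j + 1 := by positivity
  refine (key (δ / (1 / w j + 1)) (by positivity)).trans (le_of_eq ?_)
  field_simp
  ring

end Kuratowski

/-- Segments from a small loop to a nearby point stay in the convex hull and close to `X`, so the
retraction turns them into a nullhomotopy. The hull serves as ambient space because `X`, possibly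
incomplete, is closed in it. -/
theorem IsUniformANR.smallLoopsNullhomotopic {X : Type u} [UniformSpace X]
    (h : IsUniformANR X) : SmallLoopsNullhomotopic X := by
  rcases isEmpty_or_nonempty X with hX | ⟨⟨x₀⟩⟩
  · exact ⟨univ, univ_mem, fun _ c => isEmptyElim c⟩
  obtain ⟨⟨_, _⟩, hr⟩ := h
  let _ : MetricSpace X := UniformSpace.metricSpace X
  let K := convexHull ℝ (range (kuratowskiMap x₀))
  have hK : ∀ x, kuratowskiMap x₀ x ∈ K := fun x => subset_convexHull ℝ _ (mem_range_self x)
  let i : X → K := fun x => ⟨kuratowskiMap x₀ x, hK x⟩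
  have hi : Isometry i := Isometry.of_dist_eq (isometry_kuratowskiMap x₀).dist_eq
  have hcl : IsClosed (range i) := by
    refine isClosed_of_closure_subset fun F hF => ?_
    have : F.1 ∈ closure (range (kuratowskiMap x₀)) := by
      have h2 := image_closure_subset_closure_image (s := range i) continuous_subtype_val
        (mem_image_of_mem Subtype.val hF)
      rwa [← range_comp] at h2
    obtain ⟨x, hx⟩ := mem_range_kuratowskiMap_of_mem_closure x₀ F.2 this
    exact ⟨x, Subtype.ext hx⟩
  obtain ⟨N, ⟨V, hV, hVN⟩, r, hrc, hri⟩ :=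
    hr K ⟨inferInstance, inferInstance⟩ i hi.isUniformEmbedding hcl
  obtain ⟨ε, hε, hεV⟩ := Metric.mem_uniformity_dist.1 hV
  refine ⟨{p | dist p.1 p.2 < ε}, Metric.dist_mem_uniformity hε, fun γ c hγ => ?_⟩
  have hconv : ∀ (t : unitInterval) (z : Circle),
      AffineMap.lineMap (kuratowskiMap x₀ (γ z)) (kuratowskiMap x₀ c) (t : ℝ) ∈ K := fun t z =>
    (convex_convexHull ℝ _).lineMap_mem (hK _) (hK _) t.2
  have hN : ∀ (t : unitInterval) (z : Circle), (⟨_, hconv t z⟩ : K) ∈ N := by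
    refine fun t z => hVN (γ z) _ (hεV ?_)
    change dist (kuratowskiMap x₀ (γ z)) (AffineMap.lineMap _ _ _) < ε
    rw [dist_left_lineMap, (isometry_kuratowskiMap x₀).dist_eq, Real.norm_of_nonneg t.2.1]
    exact (mul_le_of_le_one_left dist_nonneg t.2.2).trans_lt (hγ z)
  have hcont : Continuous fun p : unitInterval × Circle =>
      r ⟨⟨_, hconv p.1 p.2⟩, hN p.1 p.2⟩ := by
    refine hrc.continuous.comp (Continuous.subtype_mk (Continuous.subtype_mk ?_ _) _)
    have := (isometry_kuratowskiMap x₀).continuous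
    simp only [AffineMap.lineMap_apply_module]
    fun_prop
  refine ⟨c, ⟨⟨⟨_, hcont⟩, fun z => ?_, fun z => ?_⟩⟩⟩
  · have h1 : i (γ z) ∈ N := by simpa [i] using hN 0 z
    simpa [i] using hri _ h1
  · have h1 : i c ∈ N := by simpa [i] using hN 1 z
    simpa [i] using hri _ h1

theorem UniformlyHomotopic.nullhomotopic_of_comp {X Y : Type*} [UniformSpace X] [UniformSpace Y]
    {f : C(X, Y)} {g : C(Y, X)} (h : UniformlyHomotopic (g ∘ f) id) {A : Type*}
    [TopologicalSpace A] {γ : C(A, X)} (hγ : (f.comp γ).Nullhomotopic) : γ.Nullhomotopic := by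
  obtain ⟨H, hH, hH0, hH1⟩ := h
  obtain ⟨x, hx⟩ := hγ.comp_right g
  have h1 : (g.comp (f.comp γ)).Homotopic γ := ⟨{
    toFun := fun p => H (γ p.2, p.1)
    continuous_toFun := hH.continuous.comp (by fun_prop)
    map_zero_left := fun z => hH0 _
    map_one_left := fun z => hH1 _ }⟩
  exact ⟨x, h1.symm.trans hx⟩

/-- A metric space with arbitrarily small essential loops is not uniformly homotopy equivalent to
a space in which small loops are nullhomotopic. -/
theorem SmallLoopsNullhomotopic.not_uniformlyHomotopyEquivalent {X : Type*} {Y : Type*}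
    [PseudoMetricSpace X] [UniformSpace Y] (hY : SmallLoopsNullhomotopic Y)
    (hX : ∀ ε : ℝ, 0 < ε → ∃ γ : C(Circle, X), Metric.diam (range γ) < ε ∧ ¬ γ.Nullhomotopic) :
    ¬ UniformlyHomotopyEquivalent X Y := by
  rintro ⟨f, g, hf, hg, hgf, -⟩
  obtain ⟨V, hV, hVY⟩ := hY
  obtain ⟨ε, hε, hεV⟩ := Metric.mem_uniformity_dist.1 (hf hV)
  obtain ⟨γ, hγ, hγn⟩ := hX ε hε
  -- Needed because `Metric.diam` of an unbounded set is `0` by convention.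
  have hb : Bornology.IsBounded (range γ) := (isCompact_range γ.continuous).isBounded
  refine hγn (UniformlyHomotopic.nullhomotopic_of_comp (f := ⟨f, hf.continuous⟩)
    (g := ⟨g, hg.continuous⟩) hgf (hVY _ (f (γ 1)) fun z => hεV ?_))
  exact (Metric.dist_le_diam_of_mem hb (mem_range_self z) (mem_range_self 1)).trans_lt hγ

/-! ### The preposet and its charge. -/

namespace Preposet

/-- The natural numbers with the usual order, except that numbers whose difference is congruent
to `2` modulo `4` are unrelated. -/
def natModFour : Preposet ℕ where
  rel i j := i ≤ j ∧ j % 4 ≠ (i + 2) % 4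
  rel_refl p := ⟨le_rfl, by omega⟩
  closure_antisymm p q hpq hqp := by
    have key : ∀ {a b : ℕ}, Relation.ReflTransGen
        (fun i j => i ≤ j ∧ j % 4 ≠ (i + 2) % 4) a b → a ≤ b := by
      intro a b h
      induction h with
      | refl => exact le_rfl
      | tail _ h ih => exact ih.trans h.1
    exact le_antisymm (key hpq) (key hqp)

theorem natModFour_rel {i j : ℕ} : natModFour.rel i j ↔ i ≤ j ∧ j % 4 ≠ (i + 2) % 4 := Iff.rfl

/-- Consecutive numbers are related, so chains of unit steps recover the usual order. -/
theorem natModFour_reflTransGen {a b : ℕ} :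
    Relation.ReflTransGen natModFour.rel a b ↔ a ≤ b := by
  refine ⟨fun h => ?_, fun h => ?_⟩
  · induction h with
    | refl => exact le_rfl
    | tail _ h ih => exact ih.trans h.1
  · induction b, h using Nat.le_induction with
    | base => exact .refl
    | succ n _ ih => exact ih.tail ⟨Nat.le_succ n, by omega⟩

theorem natModFour_vertex (p s : ℕ) : natModFour.vertex p s = if s ≤ p then 1 else 0 := by
  simp [vertex, cone, natModFour_reflTransGen, indicator_apply]

theorem re_I_pow_mul_conj_nonneg {i j : ℕ} (h : natModFour.rel i j ∨ natModFour.rel j i) :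
    0 ≤ (Complex.I ^ i * starRingEnd ℂ (Complex.I ^ j)).re := by
  rw [Complex.I_pow_eq_pow_mod i, Complex.I_pow_eq_pow_mod j]
  have hi := Nat.mod_lt i (show 4 > 0 by norm_num)
  have hj := Nat.mod_lt j (show 4 > 0 by norm_num)
  have hij : i % 4 ≠ (j % 4 + 2) % 4 := by
    simp only [natModFour_rel] at h
    omega
  generalize i % 4 = a at *
  generalize j % 4 = b at *
  interval_cases a <;> interval_cases b <;> simp [pow_succ] at hij ⊢

/-- The value of a point of the cube at a number, as a real number. -/
abbrev height (f : UniformFun ℕ unitInterval) (s : ℕ) : ℝ :=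
  ((UniformFun.toFun f s : unitInterval) : ℝ)

/-- A point of the realization is a convex combination of the vertices of a chain. -/
theorem exists_weights {f : UniformFun ℕ unitInterval} (hf : f ∈ natModFour.realization) :
    ∃ (ι : Type) (_ : Fintype ι) (w : ι → ℝ) (p : ι → ℕ), (∀ i, 0 ≤ w i) ∧ ∑ i, w i = 1 ∧
      (∀ i j, 0 ≤ (Complex.I ^ p i * starRingEnd ℂ (Complex.I ^ p j)).re) ∧
      ∀ s, height f s = ∑ i, w i * if s ≤ p i then 1 else 0 := by
  obtain ⟨C, -, -, hC, hf⟩ := hf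
  rw [mem_convexHull_iff_exists_fintype] at hf
  obtain ⟨ι, _, w, z, hw0, hw1, hz, hfz⟩ := hf
  choose p hpC hp using hz
  refine ⟨ι, inferInstance, w, p, hw0, hw1, fun i j => re_I_pow_mul_conj_nonneg ?_, fun s => ?_⟩
  · by_cases hij : p i = p j
    · exact .inl (hij ▸ natModFour.rel_refl _)
    · exact hC (hpC i) (hpC j) hij
  · have h : _ = height f s := congrFun hfz s
    rw [← h]
    simp [← hp, natModFour_vertex]

/-- The sum of the masses at the points of `[0, N)`, each rotated according to its residue
modulo `4`. -/
noncomputable def partialCharge (N : ℕ) (f : UniformFun ℕ unitInterval) : ℂ :=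
  ∑ s ∈ Finset.range N,
    ((height f s - height f (s + 1) : ℝ) : ℂ) * Complex.I ^ s

/-- The total rotated mass. -/
noncomputable def charge (f : UniformFun ℕ unitInterval) : ℂ :=
  ∑' s, ((height f s - height f (s + 1) : ℝ) : ℂ) * Complex.I ^ s

section Weights

variable {ι : Type*} {t : Finset ι} {w : ι → ℝ} {p : ι → ℕ} {f : UniformFun ℕ unitInterval}

theorem mass_eq (hf : ∀ s, height f s = ∑ i ∈ t, w i * if s ≤ p i then 1 else 0)
    (s : ℕ) : height f s - height f (s + 1) =
      ∑ i ∈ t, if s = p i then w i else 0 := by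
  rw [hf, hf, ← Finset.sum_sub_distrib]
  refine Finset.sum_congr rfl fun i _ => ?_
  rcases lt_trichotomy s (p i) with h | h | h
  · simp [h.le, Nat.succ_le_of_lt h, h.ne]
  · simp [h]
  · simp [h.not_ge, h.ne', (h.trans (Nat.lt_succ_self s)).not_ge]

theorem partialCharge_eq
    (hf : ∀ s, height f s = ∑ i ∈ t, w i * if s ≤ p i then 1 else 0) (N : ℕ) :
    partialCharge N f = ∑ i ∈ t, if p i < N then (w i : ℂ) * Complex.I ^ p i else 0 := by
  simp only [partialCharge, mass_eq hf, Complex.ofReal_sum, Finset.sum_mul]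
  rw [Finset.sum_comm]
  refine Finset.sum_congr rfl fun i _ => ?_
  have h := Finset.sum_ite_eq' (Finset.range N) (p i) fun s => (w i : ℂ) * Complex.I ^ s
  simp only [Finset.mem_range] at h
  rw [← h]
  refine Finset.sum_congr rfl fun s _ => ?_
  split_ifs <;> simp

theorem charge_eq
    (hf : ∀ s, height f s = ∑ i ∈ t, w i * if s ≤ p i then 1 else 0) :
    charge f = ∑ i ∈ t, (w i : ℂ) * Complex.I ^ p i := by
  refine HasSum.tsum_eq ?_
  simp only [mass_eq hf, Complex.ofReal_sum, Finset.sum_mul]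
  refine hasSum_sum fun i _ => ?_
  convert hasSum_ite_eq (p i) ((w i : ℂ) * Complex.I ^ p i) using 2 with s
  split_ifs with h <;> simp [h]

end Weights

/-- In the direction `I ^ p j` of a point of positive mass, every mass contributes nonnegatively and
that one strictly positively. -/
theorem charge_ne_zero (f : natModFour.realization) : charge f.1 ≠ 0 := by
  obtain ⟨ι, _, w, p, hw0, hw1, hp, hf⟩ := exists_weights f.2
  obtain ⟨j, hj⟩ : ∃ j, 0 < w j := by
    by_contra! hcon
    have := Finset.sum_nonpos fun i (_ : i ∈ Finset.univ) => hcon i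
    linarith
  intro h0
  have h1 : (charge f.1 * starRingEnd ℂ (Complex.I ^ p j)).re =
      ∑ i, w i * (Complex.I ^ p i * starRingEnd ℂ (Complex.I ^ p j)).re := by
    rw [charge_eq hf, Finset.sum_mul, Complex.re_sum]
    refine Finset.sum_congr rfl fun i _ => ?_
    rw [mul_assoc, Complex.re_ofReal_mul]
  have h2 := Finset.single_le_sum
    (f := fun i => w i * (Complex.I ^ p i * starRingEnd ℂ (Complex.I ^ p j)).re)
    (fun i _ => mul_nonneg (hw0 i) (hp i j)) (Finset.mem_univ j)
  rw [← h1, h0] at h2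
  simp only [zero_mul, Complex.zero_re, Complex.mul_conj, Complex.normSq_eq_norm_sq, norm_pow,
    Complex.norm_I, one_pow, Complex.ofReal_one, Complex.one_re, mul_one] at h2
  linarith

theorem norm_charge_sub_partialCharge_le {f : UniformFun ℕ unitInterval}
    (hf : f ∈ natModFour.realization) (N : ℕ) :
    ‖charge f - partialCharge N f‖ ≤ height f N := by
  obtain ⟨ι, _, w, p, hw0, -, -, hf⟩ := exists_weights hf
  rw [charge_eq hf, partialCharge_eq hf, hf, ← Finset.sum_sub_distrib]
  refine norm_sum_le_of_le _ fun i _ => ?_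
  by_cases h : p i < N
  · simp [h, h.not_ge]
  · simp [h, not_lt.1 h, abs_of_nonneg (hw0 i)]

theorem continuous_height (s : ℕ) :
    Continuous (height · s) :=
  continuous_subtype_val.comp (UniformFun.uniformContinuous_eval _ s).continuous

theorem continuous_partialCharge (N : ℕ) : Continuous (partialCharge N) :=
  continuous_finsetSum _ fun s _ => (Complex.continuous_ofReal.comp
    ((continuous_height s).sub (continuous_height (s + 1)))).mul continuous_const

/-- Choose `N` beyond the support of `f₀`. Near `f₀` the mass on `[N, ∞)`, which is the height at
`N`, is small, and the rest of the charge is a finite sum. Since `N` depends on `f₀`, the continuity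
is not uniform, as the small loops require. -/
theorem continuous_charge : Continuous fun f : natModFour.realization => charge f.1 := by
  refine continuous_iff_continuousAt.2 fun f₀ => ?_
  obtain ⟨ι, _, w, p, hw0, hw1, hp, hf⟩ := exists_weights f₀.2
  obtain ⟨N, hN⟩ : ∃ N, height f₀.1 N = 0 := by
    refine ⟨(∑ i, p i) + 1, ?_⟩
    rw [hf]
    refine Finset.sum_eq_zero fun i _ => ?_
    have := Finset.single_le_sum (f := p) (fun _ _ => Nat.zero_le _) (Finset.mem_univ i)
    rw [if_neg (by omega), mul_zero]
  have h0 : charge f₀.1 = partialCharge N f₀.1 := by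
    have := norm_charge_sub_partialCharge_le f₀.2 N
    rw [hN, norm_le_zero_iff, sub_eq_zero] at this
    exact this
  refine tendsto_iff_norm_sub_tendsto_zero.2 (squeeze_zero (fun _ => norm_nonneg _)
    (g := fun f : natModFour.realization => height f.1 N +
      ‖partialCharge N f.1 - partialCharge N f₀.1‖) (fun f => ?_) ?_)
  · calc ‖charge f.1 - charge f₀.1‖
        = ‖(charge f.1 - partialCharge N f.1) + (partialCharge N f.1 - partialCharge N f₀.1)‖ := by
          rw [h0, sub_add_sub_cancel]
      _ ≤ _ := (norm_add_le _ _).trans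
          (add_le_add_left (norm_charge_sub_partialCharge_le f.2 N) _)
  · have hc : Continuous fun f : natModFour.realization => height f.1 N +
        ‖partialCharge N f.1 - partialCharge N f₀.1‖ :=
      ((continuous_height N).comp continuous_subtype_val).add
        (((continuous_partialCharge N).comp continuous_subtype_val).sub continuous_const).norm
    simpa [hN] using hc.tendsto f₀

/-! ### Small essential loops. -/

/-- The mass at the residue class of `c` of the point in the direction of `z` of the unit sphere
of the `ℓ¹` norm. -/
noncomputable def arcWeight (z : Circle) (c : ℕ) : ℝ :=
  max 0 ((z : ℂ) * starRingEnd ℂ (Complex.I ^ c)).re / (|(z : ℂ).re| + |(z : ℂ).im|)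

theorem abs_re_add_abs_im_pos (z : Circle) : 0 < |(z : ℂ).re| + |(z : ℂ).im| :=
  (norm_pos_iff.2 z.coe_ne_zero).trans_le (Complex.norm_le_abs_re_add_abs_im _)

theorem arcWeight_nonneg (z : Circle) (c : ℕ) : 0 ≤ arcWeight z c :=
  div_nonneg (le_max_left _ _) (abs_re_add_abs_im_pos z).le

theorem continuous_arcWeight (c : ℕ) : Continuous fun z => arcWeight z c := by
  unfold arcWeight
  exact Continuous.div (by fun_prop) (by fun_prop) fun z => (abs_re_add_abs_im_pos z).ne'

theorem arcWeight_four_mul_add (z : Circle) (k c : ℕ) :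
    arcWeight z (4 * k + c) = arcWeight z c := by
  simp [arcWeight, pow_add, pow_mul]

theorem sum_arcWeight (z : Circle) : ∑ c ∈ Finset.range 4, arcWeight z c = 1 := by
  have h := (abs_re_add_abs_im_pos z).ne'
  simp only [arcWeight, ← Finset.sum_div]
  rw [div_eq_one_iff_eq h]
  simp only [Finset.sum_range_succ, Finset.sum_range_zero, pow_succ, pow_zero]
  simp
  rcases le_total 0 (z : ℂ).re with h1 | h1 <;> rcases le_total 0 (z : ℂ).im with h2 | h2 <;>
    simp [h1, h2, abs_of_nonneg, abs_of_nonpos] <;> ring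

theorem sum_arcWeight_mul_I_pow (z : Circle) :
    ∑ c ∈ Finset.range 4, (arcWeight z c : ℂ) * Complex.I ^ c =
      ((|(z : ℂ).re| + |(z : ℂ).im|)⁻¹ : ℝ) * z := by
  -- Opposite residues carry the positive and negative parts of one coordinate of `z`.
  have key : ∀ a b : ℝ, max 0 a / b - max 0 (-a) / b = b⁻¹ * a := fun a b => by
    rcases le_total 0 a with h | h <;> simp [h, div_eq_inv_mul]
  simp only [Finset.sum_range_succ, Finset.sum_range_zero]
  apply Complex.ext
  · rw [Complex.re_ofReal_mul, ← key]
    simp only [Complex.add_re, Complex.re_ofReal_mul]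
    simp [arcWeight, pow_succ, sub_eq_add_neg]
  · rw [Complex.im_ofReal_mul, ← key]
    simp only [Complex.add_im, Complex.im_ofReal_mul]
    simp [arcWeight, pow_succ, sub_eq_add_neg]

theorem rel_of_arcWeight_ne_zero {z : Circle} {i j : ℕ} (hi : arcWeight z i ≠ 0)
    (hj : arcWeight z j ≠ 0) (hij : i ≤ j) : natModFour.rel i j := by
  refine ⟨hij, fun h => ?_⟩
  have h1 : (Complex.I : ℂ) ^ j = - Complex.I ^ i := by
    rw [Complex.I_pow_eq_pow_mod j, h, ← Complex.I_pow_eq_pow_mod, pow_add]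
    simp
  simp only [arcWeight, h1, map_neg, mul_neg, Complex.neg_re] at hi hj
  rcases le_total 0 ((z : ℂ) * starRingEnd ℂ (Complex.I ^ i)).re with h | h
  · simp only [max_eq_left (neg_nonpos.2 h), zero_div, ne_eq, not_true] at hj
  · simp only [max_eq_left h, zero_div, ne_eq, not_true] at hi

/-- The tail function of the measure which assigns to each of the numbers `4 * k + c` with
`k < n` and `c < 4` an `n`-th part of the weight of `c`. -/
noncomputable def loopFun (n : ℕ) (z : Circle) (s : ℕ) : ℝ :=
  ∑ k ∈ Finset.range n ×ˢ Finset.range 4,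
    arcWeight z k.2 / n * if s ≤ 4 * k.1 + k.2 then 1 else 0

theorem loopFun_eq (n : ℕ) (z : Circle) (s : ℕ) : loopFun n z s =
    ∑ k ∈ Finset.range n, ∑ c ∈ Finset.range 4,
      arcWeight z c / n * if s ≤ 4 * k + c then 1 else 0 :=
  Finset.sum_product _ _ _

theorem sum_arcWeight_div (n : ℕ) (z : Circle) :
    ∑ c ∈ Finset.range 4, arcWeight z c / n = (n : ℝ)⁻¹ := by
  rw [← Finset.sum_div, sum_arcWeight, one_div]

theorem loopFun_nonneg (n : ℕ) (z : Circle) (s : ℕ) : 0 ≤ loopFun n z s :=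
  Finset.sum_nonneg fun k _ => mul_nonneg (div_nonneg (arcWeight_nonneg z _) n.cast_nonneg)
    (by split_ifs <;> simp)

theorem loopFun_le_one (n : ℕ) (z : Circle) (s : ℕ) : loopFun n z s ≤ 1 := by
  calc loopFun n z s ≤ ∑ k ∈ Finset.range n, (n : ℝ)⁻¹ := by
        rw [loopFun_eq]
        refine Finset.sum_le_sum fun k _ => ?_
        rw [← sum_arcWeight_div n z]
        refine Finset.sum_le_sum fun c _ => mul_le_of_le_one_right
          (div_nonneg (arcWeight_nonneg z _) n.cast_nonneg) ?_
        split_ifs <;> simp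
    _ ≤ 1 := by
        rw [Finset.sum_const, Finset.card_range, nsmul_eq_mul]
        exact mul_inv_le_one

/-- Pushing each block's mass to its first element `4 * k` only lowers tails, and the result no
longer depends on `z`. -/
theorem le_loopFun (n : ℕ) (z : Circle) (s : ℕ) :
    ∑ k ∈ Finset.range n, (n : ℝ)⁻¹ * (if s ≤ 4 * k then 1 else 0) ≤ loopFun n z s := by
  rw [loopFun_eq]
  refine Finset.sum_le_sum fun k _ => ?_
  rw [← sum_arcWeight_div n z, Finset.sum_mul]
  refine Finset.sum_le_sum fun c _ => mul_le_mul_of_nonneg_left ?_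
    (div_nonneg (arcWeight_nonneg z _) n.cast_nonneg)
  split_ifs <;> first | omega | norm_num

/-- The same push affects the tail at `s` only through the block containing `s`, namely `k = s / 4`,
of mass `1/n`. -/
theorem loopFun_le (n : ℕ) (z : Circle) (s : ℕ) :
    loopFun n z s ≤
      ∑ k ∈ Finset.range n, (n : ℝ)⁻¹ * (if s ≤ 4 * k then 1 else 0) + (n : ℝ)⁻¹ := by
  calc loopFun n z s ≤ ∑ k ∈ Finset.range n, ((n : ℝ)⁻¹ * (if s ≤ 4 * k then 1 else 0) +
        if k = s / 4 then (n : ℝ)⁻¹ else 0) := by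
        rw [loopFun_eq]
        refine Finset.sum_le_sum fun k _ => ?_
        calc _ ≤ ∑ c ∈ Finset.range 4, arcWeight z c / n *
              ((if s ≤ 4 * k then 1 else 0) + if k = s / 4 then 1 else 0) := by
              refine Finset.sum_le_sum fun c hc => mul_le_mul_of_nonneg_left ?_
                (div_nonneg (arcWeight_nonneg z _) n.cast_nonneg)
              rw [Finset.mem_range] at hc
              split_ifs <;> first | omega | norm_num
          _ = _ := by
              rw [← Finset.sum_mul, sum_arcWeight_div]
              simp [mul_add]
    _ ≤ _ := by
        rw [Finset.sum_add_distrib, Finset.sum_ite_eq']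
        gcongr
        split_ifs <;> simp

theorem abs_loopFun_sub_le (n : ℕ) (z z' : Circle) (s : ℕ) :
    |loopFun n z s - loopFun n z' s| ≤ (n : ℝ)⁻¹ := by
  have h1 := le_loopFun n z s
  have h2 := le_loopFun n z' s
  have h3 := loopFun_le n z s
  have h4 := loopFun_le n z' s
  rw [abs_le]
  constructor <;> linarith

/-- Uniform in `s`, this gives continuity in `z` for the sup metric; the bound `1/n` gives only the
diameter. -/
theorem abs_loopFun_sub_le_sum (n : ℕ) (z z' : Circle) (s : ℕ) :
    |loopFun n z s - loopFun n z' s| ≤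
      ∑ c ∈ Finset.range 4, |arcWeight z c - arcWeight z' c| := by
  rw [loopFun_eq, loopFun_eq, ← Finset.sum_sub_distrib]
  calc _ ≤ ∑ k ∈ Finset.range n, (n : ℝ)⁻¹ *
        ∑ c ∈ Finset.range 4, |arcWeight z c - arcWeight z' c| := by
        refine (Finset.abs_sum_le_sum_abs _ _).trans (Finset.sum_le_sum fun k _ => ?_)
        rw [← Finset.sum_sub_distrib, Finset.mul_sum]
        refine (Finset.abs_sum_le_sum_abs _ _).trans (Finset.sum_le_sum fun c _ => ?_)
        rw [← sub_mul, ← sub_div, abs_mul, abs_div, Nat.abs_cast, ← div_eq_inv_mul]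
        refine mul_le_of_le_one_right (by positivity) ?_
        split_ifs <;> simp
    _ ≤ _ := by
        rw [Finset.sum_const, Finset.card_range, nsmul_eq_mul, ← mul_assoc]
        exact mul_le_of_le_one_left (Finset.sum_nonneg fun _ _ => abs_nonneg _) mul_inv_le_one

/-- The point of the cube with coordinates `loopFun n z`. -/
noncomputable def loopPoint (n : ℕ) (z : Circle) : UniformFun ℕ unitInterval :=
  UniformFun.ofFun fun s => ⟨loopFun n z s, loopFun_nonneg n z s, loopFun_le_one n z s⟩

theorem height_loopPoint (n : ℕ) (z : Circle) (s : ℕ) :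
    height (loopPoint n z) s = loopFun n z s := rfl

theorem loopPoint_mem_realization {n : ℕ} (hn : 0 < n) (z : Circle) :
    loopPoint n z ∈ natModFour.realization := by
  refine ⟨{m | m < 4 * n ∧ arcWeight z m ≠ 0}, (finite_lt_nat (4 * n)).subset fun m hm => hm.1,
    ?_, fun i hi j hj _ => ?_, ?_⟩
  · obtain ⟨c, hc, hcz⟩ := Finset.exists_ne_zero_of_sum_ne_zero
      ((sum_arcWeight z).trans_ne one_ne_zero)
    rw [Finset.mem_range] at hc
    exact ⟨c, by omega, hcz⟩
  · exact (le_total i j).imp (rel_of_arcWeight_ne_zero hi.2 hj.2)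
      (rel_of_arcWeight_ne_zero hj.2 hi.2)
  -- Terms of weight zero are dropped, since their vertices need not belong to the chain.
  · have hsum : (fun s => height (loopPoint n z) s) =
        ∑ k ∈ (Finset.range n ×ˢ Finset.range 4) with arcWeight z k.2 ≠ 0,
          (arcWeight z k.2 / n) • natModFour.vertex (4 * k.1 + k.2) := by
      funext s
      rw [Finset.sum_filter_of_ne (p := fun k : ℕ × ℕ => arcWeight z k.2 ≠ 0)
        (by intro k _ h h0; exact h (by simp [h0]))]
      simp [height_loopPoint, loopFun, natModFour_vertex]
    change (fun s => height (loopPoint n z) s) ∈ _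
    rw [hsum]
    refine (convex_convexHull ℝ _).sum_mem
      (fun k _ => div_nonneg (arcWeight_nonneg z _) n.cast_nonneg) ?_ fun k hk => ?_
    · rw [Finset.sum_filter_of_ne (p := fun k : ℕ × ℕ => arcWeight z k.2 ≠ 0)
        (by intro k _ h h0; exact h (by simp [h0])), Finset.sum_product]
      simp only [sum_arcWeight_div]
      rw [Finset.sum_const, Finset.card_range, nsmul_eq_mul, mul_inv_cancel₀]
      exact_mod_cast hn.ne'
    · simp only [Finset.mem_filter, Finset.mem_product, Finset.mem_range] at hk
      refine subset_convexHull ℝ _ ⟨_, ⟨by omega, ?_⟩, rfl⟩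
      rw [arcWeight_four_mul_add]
      exact hk.2

theorem charge_loopPoint {n : ℕ} (hn : 0 < n) (z : Circle) :
    charge (loopPoint n z) = ((|(z : ℂ).re| + |(z : ℂ).im|)⁻¹ : ℝ) * z := by
  have hn' : (n : ℂ) ≠ 0 := by exact_mod_cast hn.ne'
  rw [charge_eq (t := Finset.range n ×ˢ Finset.range 4) (w := fun k => arcWeight z k.2 / n)
    (p := fun k => 4 * k.1 + k.2) fun s => rfl, ← sum_arcWeight_mul_I_pow, Finset.sum_product]
  have : ∀ k c : ℕ, ((arcWeight z c / n : ℝ) : ℂ) * Complex.I ^ (4 * k + c) =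
      (n : ℂ)⁻¹ * ((arcWeight z c : ℂ) * Complex.I ^ c) := fun k c => by
    rw [pow_add, pow_mul, Complex.I_pow_four, one_pow]
    push_cast
    ring
  simp only [this, ← Finset.mul_sum, Finset.sum_const, Finset.card_range, nsmul_eq_mul]
  rw [inv_mul_cancel_left₀ hn']

/-- The loop of uniformly distributed measures on pairs of residue classes of `[0, 4 * n)`. -/
noncomputable def loop {n : ℕ} (hn : 0 < n) : C(Circle, natModFour.realization) where
  toFun z := ⟨loopPoint n z, loopPoint_mem_realization hn z⟩
  continuous_toFun := by
    refine continuous_iff_continuousAt.2 fun z₀ => tendsto_iff_dist_tendsto_zero.2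
      (squeeze_zero (fun _ => dist_nonneg)
        (g := fun z => ∑ c ∈ Finset.range 4, |arcWeight z c - arcWeight z₀ c|)
        (fun z => (UniformFun.dist_le (Finset.sum_nonneg fun _ _ => abs_nonneg _)).2 fun s =>
          abs_loopFun_sub_le_sum n z z₀ s) ?_)
    have hc : Continuous fun z => ∑ c ∈ Finset.range 4, |arcWeight z c - arcWeight z₀ c| :=
      continuous_finsetSum _ fun c _ => ((continuous_arcWeight c).sub continuous_const).abs
    simpa using hc.tendsto z₀

theorem diam_range_loop_le {n : ℕ} (hn : 0 < n) : Metric.diam (range (loop hn)) ≤ (n : ℝ)⁻¹ := by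
  refine Metric.diam_le_of_forall_dist_le (by positivity) ?_
  rintro _ ⟨z, rfl⟩ _ ⟨z', rfl⟩
  exact (UniformFun.dist_le (by positivity)).2 fun s => abs_loopFun_sub_le n z z' s

theorem not_nullhomotopic_loop {n : ℕ} (hn : 0 < n) : ¬ (loop hn).Nullhomotopic :=
  not_nullhomotopic_of_comp_eq_smul (loop hn) continuous_charge charge_ne_zero fun z =>
    ⟨_, inv_pos.2 (abs_re_add_abs_im_pos z), charge_loopPoint hn z⟩

theorem exists_small_essential_loop (ε : ℝ) (hε : 0 < ε) :
    ∃ γ : C(Circle, natModFour.realization), Metric.diam (range γ) < ε ∧ ¬ γ.Nullhomotopic := by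
  obtain ⟨n, hn⟩ := exists_nat_one_div_lt hε
  refine ⟨loop n.succ_pos, (diam_range_loop_le _).trans_lt ?_, not_nullhomotopic_loop _⟩
  simpa using hn

end Preposet

theorem mainTheorem11 :
    ∃ (P : Type) (_ : Countable P) (R : Preposet P),
      (∀ (X : Type u) [UniformSpace X], IsUniformANR X →
        ¬ UniformlyHomotopyEquivalent R.realization X) ∧
      (∀ (X : Type u) [UniformSpace X], IsUniformlyMetrizable X →
        UniformlyLocallyContractible X →
        ¬ UniformlyHomotopyEquivalent R.realization X) ∧
      (∀ ε : ℝ, 0 < ε → ∃ γ : C(Circle, R.realization),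
        Metric.diam (range γ) < ε ∧ ¬ γ.Nullhomotopic) :=
  ⟨ℕ, inferInstance, Preposet.natModFour,
    fun _ _ hX => hX.smallLoopsNullhomotopic.not_uniformlyHomotopyEquivalent
      Preposet.exists_small_essential_loop,
    fun _ _ _ hX => hX.smallLoopsNullhomotopic.not_uniformlyHomotopyEquivalent
      Preposet.exists_small_essential_loop,
    Preposet.exists_small_essential_loop⟩
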